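/- **Theorem 1 (Convergence to common traversing times).** Let $n$ robots move on a cycle graph of length $L$, represented by $[0,L]$ with $0$ and $L$ identified. Robot $i$ has maximum speed $v_i>0$, communication radius $r_i\ge 0$, position $p_i(t)$, orientation $o_i(t)\in\{-1,+1\}$ and activity $a_i(t)\in\{0,1\}$; the robots are numbered along the cycle, and indices are cyclic. Assume that $2\sum_{i=1}^n r_i<L$. Between robots $i$ and $i+1$ there is a boundary $y_i(t)$, which may be still unknown. Assume: * (A1) the boundary between robots $n$ and $1$ is fixed and known: $y_n(t)=L$ for all $t\ge 0$, which for robot $1$ is the boundary $y_0(t)=0$; the boundaries $y_1,\dots,y_{n-1}$ are unknown at $t=0$; * (A2) $o_i(0)\ne o_j(0)$ for some $i\ne j$; * (A3) the communication zones $[p_i(0)-r_i,\,p_i(0)+r_i]$ lie in $[0,L]$ in the order of the robots and do not overlap (they may touch), and $a_i(0)=1$ for all $i$. Between events $\dot p_i=v_ia_io_i$, and $o_i$, $a_i$, $y_i$ are constant. An event takes place as soon as its condition holds; simultaneous events are executed one after the other, in any order. The events are the following; quantities that are not mentioned do not change. * *Discovery* ($1\le i<n$): if $y_i$ is unknown,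 $a_i=a_{i+1}=1$, $o_i=+1$, $o_{i+1}=-1$ and $p_i+r_i=p_{i+1}-r_{i+1}$, then $y_i:=p_i+r_i$, $o_i:=-1$, $o_{i+1}:=+1$. * *Catch* ($1\le i<n$): if $y_i$ is unknown, $p_i+r_i=p_{i+1}-r_{i+1}$, $a_i=1$, $o_i=o_{i+1}=+1$, and either $a_{i+1}=0$ or $v_{i+1}<v_i$, then $y_i:=p_i+r_i$, $a_i:=0$, $a_{i+1}:=1$. Symmetrically, if $y_i$ is unknown, $p_i+r_i=p_{i+1}-r_{i+1}$, $a_{i+1}=1$, $o_i=o_{i+1}=-1$, and either $a_i=0$ or $v_i<v_{i+1}$, then $y_i:=p_i+r_i$, $a_{i+1}:=0$, $a_i:=1$. * *Arrival*: if $a_i=1$, $o_i=+1$, $y_i$ is known, $p_i+r_i=y_i$, and robot $i+1$ is not waiting at $y_i$, then $a_i:=0$. Symmetrically, if $a_i=1$, $o_i=-1$, $y_{i-1}$ is known, $p_i-r_i=y_{i-1}$, and robot $i-1$ is not waiting at $y_{i-1}$, then $a_i:=0$. * *Meeting*: if $o_i=+1$, $o_{i+1}=-1$ and both robots are at their known common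 boundary, $p_i+r_i=y_i=p_{i+1}-r_{i+1}$ (for $i=n$: $p_n+r_n=L$ and $p_1-r_1=0$), then $o_i:=-1$, $o_{i+1}:=+1$, $a_i:=a_{i+1}:=1$, and, if $i<n$ and $y_{i-1}$, $y_{i+1}$ are both known, $$y_i:=\frac{v_{i+1}(y_{i-1}+2r_i)+v_i(y_{i+1}-2r_{i+1})}{v_i+v_{i+1}}.$$ Let $d_i(t)=y_i(t)-y_{i-1}(t)$ (with $y_0=0$) be the region lengths and $e_i(t)=(d_i(t)-2r_i)/v_i$ the traversing times. Then in every run of the team the events do not accumulate in finite time, all boundaries are known from some time on, and for every $i=1,\dots,n$, as $t\to\infty$, $$e_i(t)\to t_\star=\frac{L-2\sum_{j=1}^n r_j}{\sum_{j=1}^n v_j},\qquad d_i(t)\to d_i^\star=v_it_\star+2r_i,\qquad y_i(t)\to y_i^\star=\sum_{j=1}^i d_j^\star .$$ -/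

import Mathlib

namespace CycleRobots

/-- The data of a team of `n` robots on a cycle graph of total length `L`, cut open at position `0`
(which is identified with position `L`): maximum speeds `v i > 0` and communication radii
`r i ≥ 0`. Robots are numbered `0, …, n - 1` along the cycle graph. -/
structure Team (n : ℕ) where
  L : ℝ
  v : Fin n → ℝ
  r : Fin n → ℝ
  v_pos : ∀ i, 0 < v i
  r_nonneg : ∀ i, 0 ≤ r i

/-- The state of the team at an instant: positions, orientations (`1` forward, `-1` backward),
activities (`true` moving, `false` stopped), and boundaries. The boundaries are numbered
`0, …, n`; robot `i` lies between boundary `i` (written `i.castSucc`) and boundary `i + 1`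
(written `i.succ`). A boundary that has not been initialized yet is `none`. Boundaries `0` and `n`
are the two copies of the boundary between the last and the first robot. -/
structure State (n : ℕ) where
  p : Fin n → ℝ
  o : Fin n → ℤˣ
  a : Fin n → Bool
  y : Fin (n + 1) → Option ℝ

variable {n : ℕ}

/-- The assumptions on the initial state. -/
structure IsInitial (R : Team n) (s : State n) : Prop where
  /-- The boundary between the last and the first robot is placed at `L`, that is, at `0`. -/
  left_fixed : s.y 0 = some 0
  right_fixed : s.y (Fin.last n) = some R.L
  /-- All the other boundaries are unknown. -/
  unknown : ∀ j, j ≠ 0 → j ≠ Fin.last n → s.y j = none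
  /-- Not all the orientations are equal. -/
  orientations : ∃ i j, i ≠ j ∧ s.o i ≠ s.o j
  /-- The communication zones `[p i - r i, p i + r i]` are placed in `[0, L]` in the order of the
  robots, without overlapping. -/
  zone_first : ∀ i : Fin n, i.castSucc = 0 → 0 ≤ s.p i - R.r i
  zone_next : ∀ i j : Fin n, i.succ = j.castSucc → s.p i + R.r i ≤ s.p j - R.r j
  zone_last : ∀ i : Fin n, i.succ = Fin.last n → s.p i + R.r i ≤ R.L
  /-- All the robots are active. -/
  active : ∀ i, s.a i = true

/-- The motion between events during a time `τ`: `p i` has velocity `v i * a i * o i`, and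
nothing else changes. -/
def flow (R : Team n) (s : State n) (τ : ℝ) : State n :=
  { s with p := fun i => s.p i + τ * (R.v i * (if s.a i = true then 1 else 0) * ((s.o i : ℤ) : ℝ)) }

/-- The communication zone of robot `i` touches its right boundary, which is known. -/
def AtRight (R : Team n) (s : State n) (i : Fin n) : Prop := s.y i.succ = some (s.p i + R.r i)

/-- The communication zone of robot `i` touches its left boundary, which is known. -/
def AtLeft (R : Team n) (s : State n) (i : Fin n) : Prop := s.y i.castSucc = some (s.p i - R.r i)

/-- `j` is the right neighbour of `i` on the cycle. -/
def Next (i j : Fin n) : Prop := i.succ = j.castSucc ∨ (i.succ = Fin.last n ∧ j.castSucc = 0)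

/-- The boundary between two neighbours `i`, `j = i + 1` after their meeting, computed from the left
boundary `yl` of `i`, the right boundary `yr` of `j`, and the common boundary `y`. As long as one of
the two robots does not know its other boundary (so that it does not execute the algorithm that
updates boundaries yet), the common boundary is kept. -/
noncomputable def meetingBoundary (R : Team n) (i j : Fin n) (yl y yr : Option ℝ) : Option ℝ :=
  match yl, yr with
  | some b, some c => some ((R.v j * (b + 2 * R.r i) + R.v i * (c - 2 * R.r j)) / (R.v i + R.v j))
  | _, _ => y

/-- The events, with the state just before and the state just after the event. -/
inductive Event (R : Team n) : State n → State n → Prop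
  /-- Two robots that move towards each other discover each other and set their boundary. -/
  | discovery (s : State n) (i j : Fin n) (hij : i.succ = j.castSucc) (hy : s.y i.succ = none)
      (hai : s.a i = true) (haj : s.a j = true) (hoi : s.o i = 1) (hoj : s.o j = -1)
      (hp : s.p i + R.r i = s.p j - R.r j) :
      Event R s
        { s with
          o := Function.update (Function.update s.o i (-1)) j 1
          y := Function.update s.y i.succ (some (s.p i + R.r i)) }
  /-- Robot `i`, moving forward, catches its right neighbour `j`. -/
  | catchForward (s : State n) (i j : Fin n) (hij : i.succ = j.castSucc) (hy : s.y i.succ = none)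
      (hai : s.a i = true) (hoi : s.o i = 1) (hoj : s.o j = 1)
      (haj : s.a j = false ∨ (s.a j = true ∧ R.v j < R.v i))
      (hp : s.p i + R.r i = s.p j - R.r j) :
      Event R s
        { s with
          a := Function.update (Function.update s.a i false) j true
          y := Function.update s.y i.succ (some (s.p i + R.r i)) }
  /-- Robot `j`, moving backward, catches its left neighbour `i`. -/
  | catchBackward (s : State n) (i j : Fin n) (hij : i.succ = j.castSucc) (hy : s.y i.succ = none)
      (haj : s.a j = true) (hoi : s.o i = -1) (hoj : s.o j = -1)
      (hai : s.a i = false ∨ (s.a i = true ∧ R.v i < R.v j))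
      (hp : s.p i + R.r i = s.p j - R.r j) :
      Event R s
        { s with
          a := Function.update (Function.update s.a i true) j false
          y := Function.update s.y i.succ (some (s.p i + R.r i)) }
  /-- Robot `i` arrives at its right boundary, where its right neighbour is not waiting. -/
  | arrivalRight (s : State n) (i : Fin n) (hai : s.a i = true) (hoi : s.o i = 1)
      (hi : AtRight R s i)
      (hw : ∀ j, Next i j → ¬ (s.a j = false ∧ s.o j = -1 ∧ AtLeft R s j)) :
      Event R s { s with a := Function.update s.a i false }
  /-- Robot `j` arrives at its left boundary, where its left neighbour is not waiting. -/
  | arrivalLeft (s : State n) (j : Fin n) (haj : s.a j = true) (hoj : s.o j = -1)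
      (hj : AtLeft R s j)
      (hw : ∀ i, Next i j → ¬ (s.a i = false ∧ s.o i = 1 ∧ AtRight R s i)) :
      Event R s { s with a := Function.update s.a j false }
  /-- Two neighbours meet at their common boundary, update it, and turn back. -/
  | meeting (s : State n) (i j : Fin n) (hij : i.succ = j.castSucc)
      (hoi : s.o i = 1) (hoj : s.o j = -1) (hi : AtRight R s i) (hj : AtLeft R s j) :
      Event R s
        { s with
          o := Function.update (Function.update s.o i (-1)) j 1
          a := Function.update (Function.update s.a i true) j true
          y := Function.update s.y i.succ
            (meetingBoundary R i j (s.y i.castSucc) (s.y i.succ) (s.y j.succ)) }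
  /-- The last robot `i` and the first robot `j` meet at their fixed boundary, and turn back. -/
  | meetingFixed (s : State n) (i j : Fin n) (hi' : i.succ = Fin.last n) (hj' : j.castSucc = 0)
      (hoi : s.o i = 1) (hoj : s.o j = -1) (hi : AtRight R s i) (hj : AtLeft R s j) :
      Event R s
        { s with
          o := Function.update (Function.update s.o i (-1)) j 1
          a := Function.update (Function.update s.a i true) j true }

/-- Some event takes place in the state `s`. -/
def Enabled (R : Team n) (s : State n) : Prop := ∃ s', Event R s s'

/-- One step of a run, with its duration: the robots move until the first instant at which an event
takes place, and one of the events of that instant is executed (simultaneous events are executed one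
after the other, in any order, by steps of duration `0`). If no event would ever take place, the
motion goes on forever, cut in pieces of duration `1`. -/
inductive Step (R : Team n) : State n → ℝ → State n → Prop
  | event (s s' : State n) (τ : ℝ) (hτ : 0 ≤ τ)
      (hfirst : ∀ τ', 0 ≤ τ' → τ' < τ → ¬ Enabled R (flow R s τ'))
      (hev : Event R (flow R s τ) s') : Step R s τ s'
  | idle (s : State n) (hnone : ∀ τ, 0 ≤ τ → ¬ Enabled R (flow R s τ)) : Step R s 1 (flow R s 1)

/-- A run of the team: `state k` is the state just after the `k`-th step, at time `time k`. -/
structure Run (R : Team n) where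
  state : ℕ → State n
  time : ℕ → ℝ
  time_zero : time 0 = 0
  step : ∀ k, Step R (state k) (time (k + 1) - time k) (state (k + 1))

/-- The state at time `t ≥ 0`: one moves on from the last step at or before `t`. (Meaningful if
there are only finitely many steps up to time `t`.) -/
noncomputable def Run.stateAt {R : Team n} (x : Run R) (t : ℝ) : State n :=
  flow R (x.state (sSup {k : ℕ | x.time k ≤ t})) (t - x.time (sSup {k : ℕ | x.time k ≤ t}))

/-- The position of boundary `j` (`0` if it is unknown). -/
def boundary (s : State n) (j : Fin (n + 1)) : ℝ := (s.y j).getD 0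

/-- The length of the region of robot `i`. -/
def regionLength (s : State n) (i : Fin n) : ℝ := boundary s i.succ - boundary s i.castSucc

/-- The time that robot `i` needs to traverse its region. -/
noncomputable def traversingTime (R : Team n) (s : State n) (i : Fin n) : ℝ :=
  (regionLength s i - 2 * R.r i) / R.v i

/-- The common traversing time. -/
noncomputable def tStar (R : Team n) : ℝ := (R.L - 2 * ∑ i, R.r i) / ∑ i, R.v i

/-- The goal length of the region of robot `i`. -/
noncomputable def dStar (R : Team n) (i : Fin n) : ℝ := R.v i * tStar R + 2 * R.r i

/-- The goal position of the right boundary of robot `i`. -/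
noncomputable def yStar (R : Team n) (i : Fin n) : ℝ := ∑ j ∈ Finset.Iic i, dStar R j

end CycleRobots

open CycleRobots

/-!
The orientations, not the positions, drive the proof. Discoveries and meetings exchange the
orientations of two neighbours `i`, `i + 1` from `(1, -1)` to `(-1, 1)`, and nothing else changes an
orientation; so both orientations always occur, and somewhere on the cycle two neighbours face each
other. By the `Invariant` (communication zones are disjoint across an unknown boundary, stopped
robots wait at the boundary they face, the boundary a robot faces lies ahead of it, and every region
has room for the zone of its robot) these two reach an event, so a run never idles
(`Invariant.exists_enabled`).

Cut the cycle between robots `c` and `c + 1`. Every exchange elsewhere moves a forward orientation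
one place ahead on the resulting line, every catch makes a boundary known, and every arrival stops
a robot. So a suitable combination of these quantities, the `potential`, increases at every event
unless robot `c` turns back (`Event.potential_lt`). It is bounded, so robot `c` turns back at
bounded intervals, counted in steps (`Run.exists_turns`). In particular every boundary gets known.

From then on, a meeting replaces the traversing times of the two robots by their mean with the
speeds as weights, which is an orthogonal projection (`IsAveraging.sum_sq`): the increments of the
traversing times are square summable, hence tend to zero, and since any two neighbours have equal
traversing times at bounded intervals, all differences tend to zero. The weighted sum is conserved,
which gives the limit (`tendsto_of_averaging`), for now in terms of steps.

Finally, the time of the steps tends to infinity (`Run.tendsto_time`): otherwise the first robot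
would converge to a position at both ends of its region, while its traversing time tends to
`tStar R > 0`.
-/

namespace CycleRobots

open Filter Topology

variable {n : ℕ} {R : Team n} {s s' : State n} {i j : Fin n}

/-! ### The motion between events -/

@[simp] theorem flow_o (s : State n) (τ : ℝ) : (flow R s τ).o = s.o := rfl

@[simp] theorem flow_a (s : State n) (τ : ℝ) : (flow R s τ).a = s.a := rfl

@[simp] theorem flow_y (s : State n) (τ : ℝ) : (flow R s τ).y = s.y := rfl

@[simp] theorem flow_zero (s : State n) : flow R s 0 = s := by
  cases s; simp [flow]

theorem flow_p_forward (ha : s.a i = true) (ho : s.o i = 1) (τ : ℝ) :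
    (flow R s τ).p i = s.p i + τ * R.v i := by simp [flow, ha, ho]

theorem flow_p_backward (ha : s.a i = true) (ho : s.o i = -1) (τ : ℝ) :
    (flow R s τ).p i = s.p i - τ * R.v i := by simp [flow, ha, ho]; ring

theorem flow_p_stopped (ha : s.a i = false) (τ : ℝ) : (flow R s τ).p i = s.p i := by
  simp [flow, ha]

theorem abs_flow_p_sub_le (s : State n) (i : Fin n) {τ : ℝ} (hτ : 0 ≤ τ) :
    |(flow R s τ).p i - s.p i| ≤ R.v i * τ := by
  have h0 := mul_nonneg hτ (R.v_pos i).le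
  cases ha : s.a i
  · rw [flow_p_stopped ha, sub_self, abs_zero]; linarith
  rcases Int.units_eq_one_or (s.o i) with ho | ho
  · rw [flow_p_forward ha ho, add_sub_cancel_left, abs_of_nonneg h0, mul_comm]
  · rw [flow_p_backward ha ho, sub_sub_cancel_left, abs_neg, abs_of_nonneg h0, mul_comm]

/-! ### The invariant -/

theorem ne_of_succ_eq_castSucc (h : i.succ = j.castSucc) : i ≠ j := by
  rintro rfl; simp [Fin.ext_iff] at h

theorem ne_of_orientation (hi : s.o i = 1) (hj : s.o j = -1) : i ≠ j := by
  rintro rfl; rw [hi] at hj; exact absurd hj (by decide)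

/-- The part of the invariant that concerns one robot. A stopped robot waits at the boundary it
faces. A known boundary that the robot faces lies ahead of it; a known boundary behind the robot
lies behind it as long as the other boundary is unknown (afterwards, an update may move the boundary
past the robot that has just turned away from it). The region has room for the communication
zone. -/
structure Settled (R : Team n) (s : State n) (k : Fin n) : Prop where
  stopped : s.a k = false → (s.o k = 1 ∧ AtRight R s k) ∨ (s.o k = -1 ∧ AtLeft R s k)
  left : ∀ b, s.y k.castSucc = some b → (s.y k.succ = none ∨ s.o k = -1) → b ≤ s.p k - R.r k
  right : ∀ b, s.y k.succ = some b → (s.y k.castSucc = none ∨ s.o k = 1) → s.p k + R.r k ≤ b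
  room : ∀ b c, s.y k.castSucc = some b → s.y k.succ = some c → b + 2 * R.r k ≤ c

/-- The invariant of a run: besides `Settled`, the fixed boundary is known, communication zones are
disjoint across an unknown boundary, and both orientations occur. -/
structure Invariant (R : Team n) (s : State n) : Prop where
  left_fixed : s.y 0 = some 0
  right_fixed : s.y (Fin.last n) = some R.L
  gap : ∀ i j : Fin n, i.succ = j.castSucc → s.y i.succ = none → s.p i + R.r i ≤ s.p j - R.r j
  settled : ∀ k, Settled R s k
  forward : ∃ k, s.o k = 1
  backward : ∃ k, s.o k = -1

theorem Settled.congr {k : Fin n} (h : Settled R s k) (hp : s'.p k = s.p k) (ho : s'.o k = s.o k)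
    (ha : s'.a k = s.a k) (hl : s'.y k.castSucc = s.y k.castSucc) (hr : s'.y k.succ = s.y k.succ) :
    Settled R s' k := by
  obtain ⟨h1, h2, h3, h4⟩ := h
  constructor
  · simpa only [AtRight, AtLeft, hp, ho, ha, hl, hr] using h1
  · simpa only [hp, ho, ha, hl, hr] using h2
  · simpa only [hp, ho, ha, hl, hr] using h3
  · simpa only [hp, ho, ha, hl, hr] using h4

theorem Invariant.of_initial (h : IsInitial R s) : Invariant R s where
  left_fixed := h.left_fixed
  right_fixed := h.right_fixed
  gap i j hij _ := h.zone_next i j hij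
  settled k := by
    have hl : ∀ b, s.y k.castSucc = some b → b ≤ s.p k - R.r k := by
      intro b hb
      by_cases h0 : k.castSucc = 0
      · rw [h0, h.left_fixed] at hb
        have := h.zone_first k h0
        simp only [Option.some.injEq] at hb
        linarith
      · rw [h.unknown _ h0 (Fin.castSucc_lt_last k).ne] at hb
        simp at hb
    have hr : ∀ b, s.y k.succ = some b → s.p k + R.r k ≤ b := by
      intro b hb
      by_cases h0 : k.succ = Fin.last n
      · rw [h0, h.right_fixed] at hb
        have := h.zone_last k h0
        simp only [Option.some.injEq] at hb
        linarith
      · rw [h.unknown _ (Fin.succ_ne_zero k) h0] at hb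
        simp at hb
    refine ⟨fun ha => ?_, fun b hb _ => hl b hb, fun b hb _ => hr b hb, fun b c hb hc => ?_⟩
    · rw [h.active k] at ha
      simp at ha
    · linarith [hl b hb, hr c hc]
  forward := by
    obtain ⟨i, j, -, hne⟩ := h.orientations
    rcases Int.units_eq_one_or (s.o i) with hi | hi
    · exact ⟨i, hi⟩
    · rcases Int.units_eq_one_or (s.o j) with hj | hj
      · exact ⟨j, hj⟩
      · exact absurd (hi.trans hj.symm) hne
  backward := by
    obtain ⟨i, j, -, hne⟩ := h.orientations
    rcases Int.units_eq_one_or (s.o i) with hi | hi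
    · rcases Int.units_eq_one_or (s.o j) with hj | hj
      · exact absurd (hi.trans hj.symm) hne
      · exact ⟨j, hj⟩
    · exact ⟨i, hi⟩

/-! ### Events ahead of a robot -/

theorem enabled_of_next (h : Next i j) (hoi : s.o i = 1) (hoj : s.o j = -1) (hi : AtRight R s i)
    (hj : AtLeft R s j) : Enabled R s := by
  rcases h with h | ⟨h, h'⟩
  · exact ⟨_, .meeting s i j h hoi hoj hi hj⟩
  · exact ⟨_, .meetingFixed s i j h h' hoi hoj hi hj⟩

theorem enabled_of_atRight (ha : s.a i = true) (ho : s.o i = 1) (hi : AtRight R s i) :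
    Enabled R s := by
  by_cases hw : ∀ j, Next i j → ¬ (s.a j = false ∧ s.o j = -1 ∧ AtLeft R s j)
  · exact ⟨_, .arrivalRight s i ha ho hi hw⟩
  · push Not at hw
    obtain ⟨j, hij, -, hoj, hj⟩ := hw
    exact enabled_of_next hij ho hoj hi hj

theorem enabled_of_atLeft (ha : s.a j = true) (ho : s.o j = -1) (hj : AtLeft R s j) :
    Enabled R s := by
  by_cases hw : ∀ i, Next i j → ¬ (s.a i = false ∧ s.o i = 1 ∧ AtRight R s i)
  · exact ⟨_, .arrivalLeft s j ha ho hj hw⟩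
  · push Not at hw
    obtain ⟨i, hij, -, hoi, hi⟩ := hw
    exact enabled_of_next hij hoi ho hi hj

/-- An active robot reaches the known boundary ahead of it, where an event takes place. -/
theorem enabled_flow_right {b : ℝ} (ha : s.a i = true) (ho : s.o i = 1)
    (hb : s.y i.succ = some b) :
    Enabled R (flow R s ((b - (s.p i + R.r i)) / R.v i)) := by
  refine enabled_of_atRight (i := i) ha ho ?_
  have hv := (R.v_pos i).ne'
  rw [AtRight, flow_y, hb, flow_p_forward ha ho]
  congr 1
  field_simp
  ring

theorem enabled_flow_left {b : ℝ} (ha : s.a j = true) (ho : s.o j = -1)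
    (hb : s.y j.castSucc = some b) :
    Enabled R (flow R s ((s.p j - R.r j - b) / R.v j)) := by
  refine enabled_of_atLeft (j := j) ha ho ?_
  have hv := (R.v_pos j).ne'
  rw [AtLeft, flow_y, hb, flow_p_backward ha ho]
  congr 1
  field_simp
  ring

/-- A robot with its orientation forward, followed by one with its orientation backward. -/
theorem exists_next_of_orientations (hf : ∃ k, s.o k = 1) (hb : ∃ k, s.o k = -1) :
    ∃ i j, Next i j ∧ s.o i = 1 ∧ s.o j = -1 := by
  by_contra! hno
  have hstep : ∀ i j, Next i j → s.o i = 1 → s.o j = 1 := fun i j hij hi =>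
    (Int.units_eq_one_or (s.o j)).resolve_right (hno i j hij hi)
  obtain ⟨i, hi⟩ := hf
  obtain ⟨j, hj⟩ := hb
  have hup : ∀ (i : Fin n), s.o i = 1 → ∀ m (hm : m < n), i.1 ≤ m → s.o ⟨m, hm⟩ = 1 := by
    intro i hi m hm him
    induction m, him using Nat.le_induction with
    | base => exact hi
    | succ m _ ih =>
      exact hstep _ _ (Or.inl (by simp [Fin.ext_iff])) (ih (by omega))
  have hn : 0 < n := i.pos
  have hlast := hup i hi (n - 1) (by omega) (by have := i.2; omega)
  have h0 := hstep ⟨n - 1, by omega⟩ ⟨0, hn⟩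
    (Or.inr ⟨by simp [Fin.ext_iff]; omega, by simp⟩) hlast
  have := hup _ h0 j.1 j.2 (Nat.zero_le _)
  rw [Fin.eta, hj] at this
  exact absurd this (by decide)

/-- Some pair of neighbours faces each other, so that the motion leads to an event. -/
theorem Invariant.exists_enabled (h : Invariant R s) : ∃ τ, 0 ≤ τ ∧ Enabled R (flow R s τ) := by
  obtain ⟨i, j, hij, hoi, hoj⟩ := exists_next_of_orientations h.forward h.backward
  have hstopi : s.a i = false → AtRight R s i := fun ha => by
    rcases (h.settled i).stopped ha with h | h
    · exact h.2
    · rw [hoi] at h; exact absurd h.1 (by decide)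
  have hstopj : s.a j = false → AtLeft R s j := fun ha => by
    rcases (h.settled j).stopped ha with h | h
    · rw [hoj] at h; exact absurd h.1 (by decide)
    · exact h.2
  have hvi := R.v_pos i
  have hvj := R.v_pos j
  cases hai : s.a i with
  | false =>
    have hi := hstopi hai
    cases haj : s.a j with
    | false => exact ⟨0, le_rfl, by simpa using enabled_of_next hij hoi hoj hi (hstopj haj)⟩
    | true =>
      obtain ⟨b, hb⟩ : ∃ b, s.y j.castSucc = some b := by
        rcases hij with hij | ⟨-, hj⟩
        · exact ⟨_, by rw [← hij]; exact hi⟩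
        · exact ⟨_, hj ▸ h.left_fixed⟩
      refine ⟨_, div_nonneg ?_ hvj.le, enabled_flow_left haj hoj hb⟩
      linarith [(h.settled j).left b hb (Or.inr hoj)]
  | true =>
    cases hy : s.y i.succ with
    | some b =>
      refine ⟨_, div_nonneg ?_ hvi.le, enabled_flow_right hai hoi hy⟩
      linarith [(h.settled i).right b hy (Or.inr hoi)]
    | none =>
      rcases hij with hij | ⟨hi, -⟩
      · have haj : s.a j = true := by
          by_contra haj
          have := hstopj (by simpa using haj)
          rw [AtLeft, ← hij, hy] at this
          simp at this
        refine ⟨(s.p j - R.r j - (s.p i + R.r i)) / (R.v i + R.v j),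
          div_nonneg (by linarith [h.gap i j hij hy]) (by positivity), _,
          .discovery _ i j hij hy hai haj hoi hoj ?_⟩
        rw [flow_p_forward hai hoi, flow_p_backward haj hoj]
        field_simp
        ring
      · rw [hi, h.right_fixed] at hy
        simp at hy

/-- The velocity of robot `i`. -/
def velocity (R : Team n) (s : State n) (i : Fin n) : ℝ :=
  R.v i * (if s.a i = true then 1 else 0) * ((s.o i : ℤ) : ℝ)

theorem flow_p (s : State n) (τ : ℝ) (i : Fin n) :
    (flow R s τ).p i = s.p i + τ * velocity R s i := rfl

/-- Two robots with an unknown common boundary do not approach each other once their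
communication zones touch, as they would first discover or catch each other. -/
theorem enabled_of_approach (h : ∀ k, Settled R s k) (hij : i.succ = j.castSucc)
    (hy : s.y i.succ = none) (hv : velocity R s j < velocity R s i)
    {τ : ℝ} (hp : (flow R s τ).p i + R.r i = (flow R s τ).p j - R.r j) :
    Enabled R (flow R s τ) := by
  have hstopi : s.a i = false → s.o i = -1 := fun ha => by
    rcases (h i).stopped ha with h | h
    · have := h.2; rw [AtRight, hy] at this; simp at this
    · exact h.1
  have hstopj : s.a j = false → s.o j = 1 := fun ha => by
    rcases (h j).stopped ha with h | h
    · exact h.1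
    · have := h.2; rw [AtLeft, ← hij, hy] at this; simp at this
  have hvi := R.v_pos i
  have hvj := R.v_pos j
  rcases Int.units_eq_one_or (s.o i) with hoi | hoi <;>
    rcases Int.units_eq_one_or (s.o j) with hoj | hoj
  · have hai : s.a i = true := by
      by_contra ha
      have := hstopi (by simpa using ha)
      rw [hoi] at this
      exact absurd this (by decide)
    refine ⟨_, .catchForward _ i j hij hy hai hoi hoj ?_ hp⟩
    cases haj : s.a j with
    | false => exact Or.inl haj
    | true => exact Or.inr ⟨haj, by simpa [velocity, hai, haj, hoi, hoj] using hv⟩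
  · have hai : s.a i = true := by
      by_contra ha
      have := hstopi (by simpa using ha)
      rw [hoi] at this
      exact absurd this (by decide)
    have haj : s.a j = true := by
      by_contra ha
      have := hstopj (by simpa using ha)
      rw [hoj] at this
      exact absurd this (by decide)
    exact ⟨_, .discovery _ i j hij hy hai haj hoi hoj hp⟩
  · exfalso
    revert hv
    simp only [velocity, hoi, hoj]
    split_ifs <;> simp <;> linarith
  · have haj : s.a j = true := by
      by_contra ha
      have := hstopj (by simpa using ha)
      rw [hoj] at this
      exact absurd this (by decide)
    refine ⟨_, .catchBackward _ i j hij hy haj hoi hoj ?_ hp⟩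
    cases hai : s.a i with
    | false => exact Or.inl hai
    | true => exact Or.inr ⟨hai, by simpa [velocity, hai, haj, hoi, hoj] using hv⟩

theorem Invariant.after_flow (h : Invariant R s) {τ : ℝ} (hτ : 0 ≤ τ)
    (hfirst : ∀ τ', 0 ≤ τ' → τ' < τ → ¬ Enabled R (flow R s τ')) :
    Invariant R (flow R s τ) where
  left_fixed := h.left_fixed
  right_fixed := h.right_fixed
  forward := h.forward
  backward := h.backward
  gap i j hij hy := by
    by_contra! hlt
    have hg := h.gap i j hij hy
    rw [flow_p, flow_p] at hlt
    have hv : velocity R s j < velocity R s i := by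
      by_contra! hle
      nlinarith [mul_le_mul_of_nonneg_left hle hτ]
    have hv' : 0 < velocity R s i - velocity R s j := sub_pos.2 hv
    refine hfirst ((s.p j - R.r j - (s.p i + R.r i)) / (velocity R s i - velocity R s j))
      (div_nonneg (by linarith) hv'.le) ?_
      (enabled_of_approach h.settled hij hy hv ?_)
    · rw [div_lt_iff₀ hv']; linarith
    · rw [flow_p, flow_p]; field_simp; ring
  settled k := by
    have hk := h.settled k
    have hv := R.v_pos k
    have hτv := mul_nonneg hτ hv.le
    refine ⟨fun ha => ?_, fun b hb hc => ?_, fun b hb hc => ?_, hk.room⟩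
    · simpa only [AtRight, AtLeft, flow_y, flow_o, flow_p_stopped (s := s) ha] using hk.stopped ha
    · have hle := hk.left b hb hc
      cases ha : s.a k with
      | false => rwa [flow_p_stopped ha]
      | true =>
        rcases Int.units_eq_one_or (s.o k) with ho | ho
        · rw [flow_p_forward ha ho]; linarith
        · by_contra! hlt
          rw [flow_p_backward ha ho] at hlt
          exact hfirst _ (div_nonneg (by linarith) hv.le)
            (by rw [div_lt_iff₀ hv]; linarith) (enabled_flow_left ha ho hb)
    · have hle := hk.right b hb hc
      cases ha : s.a k with
      | false => rwa [flow_p_stopped ha]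
      | true =>
        rcases Int.units_eq_one_or (s.o k) with ho | ho
        · by_contra! hlt
          rw [flow_p_forward ha ho] at hlt
          exact hfirst _ (div_nonneg (by linarith) hv.le)
            (by rw [div_lt_iff₀ hv]; linarith) (enabled_flow_right ha ho hb)
        · rw [flow_p_backward ha ho]; linarith

/-! ### Events preserve the invariant -/

theorem Invariant.of_local (h : Invariant R s) (hp : s'.p = s.p) (h0 : s'.y 0 = s.y 0)
    (hl : s'.y (Fin.last n) = s.y (Fin.last n)) (hnone : ∀ b, s'.y b = none → s.y b = none)
    (hsettled : ∀ k, Settled R s' k) (hf : ∃ k, s'.o k = 1) (hb : ∃ k, s'.o k = -1) :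
    Invariant R s' where
  left_fixed := h0.trans h.left_fixed
  right_fixed := hl.trans h.right_fixed
  gap i j hij hy := by rw [hp]; exact h.gap i j hij (hnone _ hy)
  settled := hsettled
  forward := hf
  backward := hb

theorem succ_ne_last_of_next (h : i.succ = j.castSucc) : Fin.last n ≠ i.succ := by
  rw [h]; exact (Fin.castSucc_lt_last j).ne'

theorem meetingBoundary_isSome {yl y yr : Option ℝ} (h : y.isSome = true) :
    (meetingBoundary R i j yl y yr).isSome = true := by
  unfold meetingBoundary
  split <;> simp [h]

theorem Event.p_eq (h : Event R s s') : s'.p = s.p := by cases h <;> rfl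

theorem Event.isSome_of_isSome (h : Event R s s') {b : Fin (n + 1)} (hb : (s.y b).isSome = true) :
    (s'.y b).isSome = true := by
  cases h with
  | discovery i j | catchForward i j | catchBackward i j =>
    by_cases hbi : b = i.succ
    · subst hbi; simp
    · simpa [Function.update_of_ne hbi] using hb
  | meeting i j =>
    by_cases hbi : b = i.succ
    · subst hbi; simpa using meetingBoundary_isSome hb
    · simpa [Function.update_of_ne hbi] using hb
  | arrivalRight | arrivalLeft | meetingFixed => exact hb

theorem Event.y_zero (h : Event R s s') : s'.y 0 = s.y 0 := by
  cases h <;> rfl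

theorem Event.y_last (h : Event R s s') : s'.y (Fin.last n) = s.y (Fin.last n) := by
  cases h <;>
    first | rfl | exact Function.update_of_ne (succ_ne_last_of_next (by assumption)) _ _

/-- Discoveries and meetings exchange the orientations of two robots; the other events keep the
orientations. -/
theorem Event.orientation (h : Event R s s') :
    s'.o = s.o ∨ ∃ i j, Next i j ∧ s.o i = 1 ∧ s.o j = -1 ∧
      s'.o = Function.update (Function.update s.o i (-1)) j 1 := by
  cases h with
  | discovery i j hij hy hai haj hoi hoj => exact Or.inr ⟨i, j, Or.inl hij, hoi, hoj, rfl⟩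
  | meeting i j hij hoi hoj => exact Or.inr ⟨i, j, Or.inl hij, hoi, hoj, rfl⟩
  | meetingFixed i j hi hj hoi hoj => exact Or.inr ⟨i, j, Or.inr ⟨hi, hj⟩, hoi, hoj, rfl⟩
  | _ => exact Or.inl rfl

theorem Event.forward (h : Event R s s') (hf : ∃ k, s.o k = 1) : ∃ k, s'.o k = 1 := by
  rcases h.orientation with h | ⟨i, j, -, -, -, h⟩
  · rwa [h]
  · exact ⟨j, by rw [h]; simp⟩

theorem Event.backward (h : Event R s s') (hb : ∃ k, s.o k = -1) : ∃ k, s'.o k = -1 := by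
  rcases h.orientation with h | ⟨i, j, -, hi, hj, h⟩
  · rwa [h]
  · exact ⟨i, by rw [h, Function.update_of_ne (ne_of_orientation hi hj)]; simp⟩

/-- The new boundary leaves room for the communication zones of both robots, provided that the two
old regions had room for them. -/
theorem le_meetingBoundary {b y c z : ℝ} (h1 : b + 2 * R.r i ≤ y) (h2 : y + 2 * R.r j ≤ c)
    (hz : meetingBoundary R i j (some b) (some y) (some c) = some z) :
    b + 2 * R.r i ≤ z ∧ z + 2 * R.r j ≤ c := by
  have hvi := R.v_pos i
  have hvj := R.v_pos j
  simp only [meetingBoundary, Option.some.injEq] at hz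
  subst hz
  constructor
  · rw [le_div_iff₀ (by positivity)]; nlinarith
  · rw [← le_sub_iff_add_le, div_le_iff₀ (by positivity)]; nlinarith

/-- The one point where the invariant depends on the update rule. If the boundary is kept since one
of the outer boundaries is unknown, both robots still touch it; if it is updated, the robots turn
away from it, towards boundaries that lie ahead of them as their old regions had room for them. -/
theorem Event.settled_of_meeting (h : Invariant R s) (hij : i.succ = j.castSucc)
    (hoi : s.o i = 1) (hoj : s.o j = -1) (hi : AtRight R s i) (hj : AtLeft R s j) {k : Fin n} :
    Settled R { s with
          o := Function.update (Function.update s.o i (-1)) j 1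
          a := Function.update (Function.update s.a i true) j true
          y := Function.update s.y i.succ
            (meetingBoundary R i j (s.y i.castSucc) (s.y i.succ) (s.y j.succ)) } k := by
  have hne := ne_of_succ_eq_castSucc hij
  have hji : j.succ ≠ i.succ := fun h => hne (Fin.succ_injective _ h).symm
  have hii : i.castSucc ≠ i.succ := Fin.castSucc_lt_succ.ne
  have hi' := h.settled i
  have hj' := h.settled j
  unfold AtRight at hi
  unfold AtLeft at hj
  rw [← hij, hi, Option.some.injEq] at hj
  by_cases hki : k = i
  · subst hki
    refine ⟨?_, ?_, ?_, ?_⟩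
    · simp [hne]
    · intro b hb _
      simp only [Function.update_of_ne hii] at hb
      have := hi'.room b _ hb hi
      simp only
      linarith
    · simp only [Function.update_self, Function.update_of_ne hii, Function.update_of_ne hne]
      intro b hb hc
      have hc : s.y k.castSucc = none := hc.resolve_right (by decide)
      rw [hc, hi] at hb
      simp only [meetingBoundary, Option.some.injEq] at hb
      exact hb.le
    · simp only [Function.update_self, Function.update_of_ne hii]
      intro b c hb hc
      have h1 := hi'.room b _ hb hi
      rw [hb, hi] at hc
      cases hyj : s.y j.succ with
      | none =>
        simp only [hyj, meetingBoundary, Option.some.injEq] at hc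
        linarith
      | some d =>
        rw [hyj] at hc
        exact (le_meetingBoundary h1 (hj'.room _ d (by rw [← hij, hi]) hyj) hc).1
  by_cases hkj : k = j
  · subst hkj
    refine ⟨?_, ?_, ?_, ?_⟩
    · simp
    · simp only [← hij, Function.update_self, Function.update_of_ne hji]
      intro b hb hc
      have hc : s.y k.succ = none := hc.resolve_right (by decide)
      rw [hc, hi] at hb
      have hb : s.p i + R.r i = b := by
        revert hb; unfold meetingBoundary; split <;> simp_all
      linarith
    · intro b hb _
      simp only [Function.update_of_ne hji] at hb
      have := hj'.room _ b (by rw [← hij, hi]) hb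
      simp only
      linarith
    · simp only [← hij, Function.update_self, Function.update_of_ne hji]
      intro b c hb hc
      have h1 := hj'.room _ c (by rw [← hij, hi]) hc
      rw [hc, hi] at hb
      cases hyi : s.y i.castSucc with
      | none =>
        simp only [hyi, meetingBoundary, Option.some.injEq] at hb
        linarith
      | some d =>
        rw [hyi] at hb
        exact (le_meetingBoundary (hi'.room d _ hyi hi) h1 hb).2
  · refine (h.settled k).congr rfl ?_ ?_ ?_ ?_
    · simp [hki, hkj]
    · simp [hki, hkj]
    · exact Function.update_of_ne (fun h => hkj (Fin.castSucc_injective _ (h.trans hij))) _ _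
    · exact Function.update_of_ne (fun h => hki (Fin.succ_injective _ h)) _ _

/-- When an unknown boundary between robots `i` and `j` is set at the place where their
communication zones touch, both robots are settled as soon as a stopped one waits there. -/
theorem Event.settled_of_initialization (h : Invariant R s) (hij : i.succ = j.castSucc)
    (hy : s.y i.succ = none) (hp : s.p i + R.r i = s.p j - R.r j)
    {o : Fin n → ℤˣ} {a : Fin n → Bool}
    (ho : ∀ k, k ≠ i → k ≠ j → o k = s.o k) (ha : ∀ k, k ≠ i → k ≠ j → a k = s.a k)
    (hi : a i = false → o i = 1) (hj : a j = false → o j = -1) (k : Fin n) :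
    Settled R { s with
          o := o
          a := a
          y := Function.update s.y i.succ (some (s.p i + R.r i)) } k := by
  have hne := ne_of_succ_eq_castSucc hij
  have hji : j.succ ≠ i.succ := fun h => hne (Fin.succ_injective _ h).symm
  have hii : i.castSucc ≠ i.succ := Fin.castSucc_lt_succ.ne
  by_cases hki : k = i
  · subst hki
    have hl := fun b hb => (h.settled k).left b hb (Or.inl hy)
    refine ⟨fun ha => Or.inl ⟨hi ha, by simp [AtRight]⟩, ?_, ?_, ?_⟩
    · simp only [Function.update_of_ne hii]
      exact fun b hb _ => hl b hb
    · simp only [Function.update_self, Option.some.injEq]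
      exact fun b hb _ => hb.le
    · simp only [Function.update_self, Function.update_of_ne hii, Option.some.injEq]
      intro b c hb hc
      linarith [hl b hb]
  by_cases hkj : k = j
  · subst hkj
    have hr := fun b hb => (h.settled k).right b hb (Or.inl (hij ▸ hy))
    refine ⟨fun ha => Or.inr ⟨hj ha, by simp [AtLeft, ← hij, hp]⟩, ?_, ?_, ?_⟩
    · simp only [← hij, Function.update_self, Option.some.injEq]
      intro b hb _
      linarith
    · simp only [Function.update_of_ne hji]
      exact fun b hb _ => hr b hb
    · simp only [← hij, Function.update_self, Function.update_of_ne hji, Option.some.injEq]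
      intro b c hb hc
      linarith [hr c hc]
  · refine (h.settled k).congr rfl (ho k hki hkj) (ha k hki hkj) ?_ ?_
    · exact Function.update_of_ne (fun h => hkj (Fin.castSucc_injective _ (h.trans hij))) _ _
    · exact Function.update_of_ne (fun h => hki (Fin.succ_injective _ h)) _ _

theorem Settled.of_arrival {k : Fin n} (h : Settled R s k)
    (hk : (s.o i = 1 ∧ AtRight R s i) ∨ (s.o i = -1 ∧ AtLeft R s i)) :
    Settled R { s with a := Function.update s.a i false } k := by
  refine ⟨fun ha => ?_, h.left, h.right, h.room⟩
  by_cases hki : k = i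
  · subst hki; exact hk
  · exact h.stopped (by simpa [hki] using ha)

theorem Settled.of_meetingFixed {k : Fin n} (h : Settled R s k)
    (hoi : s.o i = 1) (hoj : s.o j = -1) (hi : AtRight R s i) (hj : AtLeft R s j) :
    Settled R { s with
          o := Function.update (Function.update s.o i (-1)) j 1
          a := Function.update (Function.update s.a i true) j true } k := by
  have hne := ne_of_orientation hoi hoj
  by_cases hki : k = i
  · subst hki
    refine ⟨by simp [hne], fun b hb _ => ?_, fun b hb hc => h.right b hb ?_, h.room⟩
    · simp only
      linarith [h.room b _ hb hi]
    · exact Or.inr hoi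
  by_cases hkj : k = j
  · subst hkj
    refine ⟨by simp, fun b hb hc => h.left b hb (Or.inr hoj), fun b hb _ => ?_, h.room⟩
    simp only
    linarith [h.room _ b hj hb]
  · exact h.congr rfl (by simp [hki, hkj]) (by simp [hki, hkj]) rfl rfl

theorem Event.settled (he : Event R s s') (h : Invariant R s) (k : Fin n) : Settled R s' k := by
  cases he with
  | discovery i j hij hy hai haj hoi hoj hp =>
    refine settled_of_initialization h hij hy hp (fun k hi hj => ?_) (fun _ _ _ => rfl) ?_ ?_ k
    · simp [hi, hj]
    · simp [hai]
    · simp [haj]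
  | catchForward i j hij hy hai hoi hoj haj hp =>
    refine settled_of_initialization h hij hy hp (fun _ _ _ => rfl) (fun k hi hj => ?_) ?_ ?_ k
    · simp [hi, hj]
    · simp [hoi]
    · simp
  | catchBackward i j hij hy haj hoi hoj hai hp =>
    refine settled_of_initialization h hij hy hp (fun _ _ _ => rfl) (fun k hi hj => ?_) ?_ ?_ k
    · simp [hi, hj]
    · simp [ne_of_succ_eq_castSucc hij]
    · simp [hoj]
  | arrivalRight i hai hoi hi hw => exact (h.settled k).of_arrival (Or.inl ⟨hoi, hi⟩)
  | arrivalLeft j haj hoj hj hw => exact (h.settled k).of_arrival (Or.inr ⟨hoj, hj⟩)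
  | meeting i j hij hoi hoj hi hj => exact settled_of_meeting h hij hoi hoj hi hj
  | meetingFixed i j hi' hj' hoi hoj hi hj => exact (h.settled k).of_meetingFixed hoi hoj hi hj

theorem Invariant.after_event (h : Invariant R s) (he : Event R s s') : Invariant R s' :=
  h.of_local he.p_eq he.y_zero he.y_last
    (fun b hb => by
      by_contra hs
      have := he.isSome_of_isSome (Option.isSome_iff_ne_none.2 hs)
      rw [hb] at this
      simp at this)
    (he.settled h) (he.forward h.forward) (he.backward h.backward)

/-! ### A potential -/

theorem sum_update {ι α : Type*} [Fintype ι] [DecidableEq ι] (F : ι → α → ℤ) (f : ι → α) (i : ι)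
    (x : α) : ∑ k, F k (Function.update f i x k) = ∑ k, F k (f k) + F i x - F i (f i) := by
  rw [← Finset.add_sum_erase _ _ (Finset.mem_univ i),
    ← Finset.add_sum_erase _ (fun k => F k (f k)) (Finset.mem_univ i), Function.update_self,
    Finset.sum_congr rfl fun k hk => by rw [Function.update_of_ne (Finset.ne_of_mem_erase hk)]]
  ring

/-- The position of robot `i` when the cycle is cut open between robot `c` and its right neighbour:
robot `c + 1` comes first and robot `c` last. -/
def cutPosition (c i : Fin n) : ℤ := if i ≤ c then i.1 + n else i.1

/-- The sum of the positions of the robots that move forward. -/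
def forwardSum (c : Fin n) (o : Fin n → ℤˣ) : ℤ :=
  ∑ k, if o k = 1 then cutPosition c k else 0

/-- The number of known boundaries. -/
def knownCount (y : Fin (n + 1) → Option ℝ) : ℤ := ∑ b, if (y b).isSome = true then 1 else 0

/-- The number of active robots. -/
def activeCount (a : Fin n → Bool) : ℤ := ∑ k, if a k = true then 1 else 0

/-- A bounded quantity that increases at every event, except when robot `c` turns back from forward
to backward. An exchange of orientations elsewhere moves a forward orientation one
position ahead; the factor `3` outweighs the at most two robots that a meeting activates. -/
def potential (c : Fin n) (s : State n) : ℤ :=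
  3 * forwardSum c s.o + knownCount s.y - activeCount s.a

theorem cutPosition_next {c : Fin n} (h : Next i j) (hi : i ≠ c) :
    cutPosition c j = cutPosition c i + 1 := by
  have := i.2
  have := j.2
  have := c.2
  simp only [Next, Fin.ext_iff, Fin.val_succ, Fin.val_castSucc, Fin.val_last, Fin.val_zero] at h
  rw [Ne, Fin.ext_iff] at hi
  simp only [cutPosition, Fin.le_def]
  split_ifs <;> omega

theorem forwardSum_turn {c : Fin n} {o : Fin n → ℤˣ} (h : Next i j) (hi : i ≠ c) (hij : i ≠ j)
    (hoi : o i = 1) (hoj : o j = -1) :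
    forwardSum c (Function.update (Function.update o i (-1)) j 1) = forwardSum c o + 1 := by
  have h1 : ((-1 : ℤˣ) = 1) = False := by decide
  unfold forwardSum
  rw [sum_update (fun k (u : ℤˣ) => if u = 1 then cutPosition c k else 0),
    sum_update (fun k (u : ℤˣ) => if u = 1 then cutPosition c k else 0)]
  simp only [Function.update_of_ne hij.symm, hoi, hoj, h1, if_true, if_false,
    cutPosition_next h hi]
  ring

theorem knownCount_update_of_none {y : Fin (n + 1) → Option ℝ} {b : Fin (n + 1)} {z : ℝ}
    (hb : y b = none) : knownCount (Function.update y b (some z)) = knownCount y + 1 := by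
  unfold knownCount
  rw [sum_update (fun k (u : Option ℝ) => if u.isSome = true then 1 else 0)]
  simp [hb]

theorem knownCount_mono {y y' : Fin (n + 1) → Option ℝ}
    (h : ∀ b, (y b).isSome = true → (y' b).isSome = true) : knownCount y ≤ knownCount y' := by
  refine Finset.sum_le_sum fun b _ => ?_
  have := h b
  split_ifs <;> simp_all

theorem activeCount_update (a : Fin n → Bool) (i : Fin n) (x : Bool) :
    activeCount (Function.update a i x) =
      activeCount a + (if x = true then 1 else 0) - if a i = true then 1 else 0 :=
  sum_update (fun _ u => if u = true then 1 else 0) a i x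

theorem Event.potential_lt {c : Fin n} (h : Event R s s') (hc : s.o c = 1 → s'.o c = 1) :
    potential c s < potential c s' := by
  have hk := knownCount_mono fun b => h.isSome_of_isSome (b := b)
  unfold potential
  have h11 : (-1 : ℤˣ) ≠ 1 := by decide
  cases h with
  | discovery i j hij hy hai haj hoi hoj hp =>
    have hne := ne_of_succ_eq_castSucc hij
    have hic : i ≠ c := by rintro rfl; simp [hoi, hne, h11] at hc
    simp only [forwardSum_turn (Or.inl hij) hic hne hoi hoj] at hk ⊢
    linarith
  | catchForward i j hij hy hai hoi hoj haj hp =>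
    have hne := ne_of_succ_eq_castSucc hij
    simp only [knownCount_update_of_none hy, activeCount_update, Function.update_of_ne hne.symm,
      hai, if_true, Bool.false_eq_true, if_false]
    split_ifs <;> omega
  | catchBackward i j hij hy haj hoi hoj hai hp =>
    have hne := ne_of_succ_eq_castSucc hij
    simp only [knownCount_update_of_none hy, activeCount_update, Function.update_of_ne hne.symm,
      haj, if_true, Bool.false_eq_true, if_false]
    split_ifs <;> omega
  | arrivalRight i hai hoi hi hw => simp [activeCount_update, hai]
  | arrivalLeft j haj hoj hj hw => simp [activeCount_update, haj]
  | meeting i j hij hoi hoj hi hj =>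
    have hne := ne_of_succ_eq_castSucc hij
    have hic : i ≠ c := by rintro rfl; simp [hoi, hne, h11] at hc
    simp only [forwardSum_turn (Or.inl hij) hic hne hoi hoj, activeCount_update, if_true] at hk ⊢
    split_ifs <;> omega
  | meetingFixed i j hi' hj' hoi hoj hi hj =>
    have hne := ne_of_orientation hoi hoj
    have hic : i ≠ c := by rintro rfl; simp [hoi, hne, h11] at hc
    simp only [forwardSum_turn (Or.inr ⟨hi', hj'⟩) hic hne hoi hoj, activeCount_update,
      if_true] at hk ⊢
    split_ifs <;> omega

theorem sum_ite_mem_Icc {ι : Type*} [Fintype ι] (p : ι → Prop) [DecidablePred p] (f : ι → ℤ)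
    {B : ℤ} (hf : ∀ k, 0 ≤ f k ∧ f k ≤ B) :
    0 ≤ ∑ k, (if p k then f k else 0) ∧ ∑ k, (if p k then f k else 0) ≤ Fintype.card ι * B := by
  constructor
  · exact Finset.sum_nonneg fun k _ => by split_ifs <;> simp [(hf k).1]
  · calc ∑ k, (if p k then f k else 0) ≤ ∑ _k : ι, B := Finset.sum_le_sum fun k _ => by
          split_ifs
          · exact (hf k).2
          · exact (hf k).1.trans (hf k).2
      _ = _ := by simp

theorem potential_bounds (c : Fin n) (s : State n) :
    -(n : ℤ) ≤ potential c s ∧ potential c s ≤ 6 * n ^ 2 + n + 1 := by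
  have h1 := sum_ite_mem_Icc (fun k => s.o k = 1) (cutPosition c) (B := 2 * n) fun k => by
    have := k.2
    unfold cutPosition
    split_ifs <;> constructor <;> omega
  have h2 := sum_ite_mem_Icc (fun b => (s.y b).isSome = true) (fun _ => 1) (B := 1) (by simp)
  have h3 := sum_ite_mem_Icc (fun k => s.a k = true) (fun _ => 1) (B := 1) (by simp)
  simp only [Fintype.card_fin, Nat.cast_add, Nat.cast_one] at h1 h2 h3
  unfold potential forwardSum knownCount activeCount
  constructor <;> nlinarith

/-! ### Averaging sequences -/

/-- The vector `e'` arises from `e` by replacing two entries by their mean with weights `v`, or is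
equal to `e`. The mean is characterized by equality of the new entries and conservation of the
weighted sum. -/
def IsAveraging {ι : Type*} (v e e' : ι → ℝ) : Prop :=
  e' = e ∨ ∃ i j, i ≠ j ∧ e' i = e' j ∧ v i * e' i + v j * e' j = v i * e i + v j * e j ∧
    ∀ k, k ≠ i ∧ k ≠ j → e' k = e k

theorem IsAveraging.sum_eq {ι : Type*} [Fintype ι] {v e e' : ι → ℝ} (h : IsAveraging v e e') :
    ∑ k, v k * e' k = ∑ k, v k * e k := by
  rcases h with rfl | ⟨i, j, hij, -, h, hk⟩
  · rfl
  rw [← sub_eq_zero, ← Finset.sum_sub_distrib,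
    Finset.sum_eq_add i j hij (fun k _ hk' => by rw [hk k hk', sub_self]) (by simp) (by simp)]
  linarith

/-- Averaging is an orthogonal projection for the inner product with weights `v`. -/
theorem IsAveraging.sum_sq {ι : Type*} [Fintype ι] {v e e' : ι → ℝ} (h : IsAveraging v e e') :
    ∑ k, v k * (e' k - e k) ^ 2 = ∑ k, v k * e k ^ 2 - ∑ k, v k * e' k ^ 2 := by
  have h0 : ∑ k, v k * e' k * (e k - e' k) = 0 := by
    rcases h with rfl | ⟨i, j, hij, heq, h, hk⟩
    · simp
    rw [Finset.sum_eq_add i j hij (fun k _ hk' => by rw [hk k hk', sub_self, mul_zero]) (by simp)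
      (by simp), ← heq]
    rw [← heq] at h
    linear_combination -(e' i) * h
  have : ∑ k, v k * (e' k - e k) ^ 2 - (∑ k, v k * e k ^ 2 - ∑ k, v k * e' k ^ 2) =
      -2 * ∑ k, v k * e' k * (e k - e' k) := by
    rw [Finset.mul_sum, ← Finset.sum_sub_distrib, ← Finset.sum_sub_distrib]
    exact Finset.sum_congr rfl fun k _ => by ring
  rw [h0, mul_zero, sub_eq_zero] at this
  exact this

theorem tendsto_increment_of_averaging {ι : Type*} [Fintype ι] {v : ι → ℝ} (hv : ∀ i, 0 < v i)
    {e : ℕ → ι → ℝ} (h : ∀ k, IsAveraging v (e k) (e (k + 1))) (i : ι) :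
    Tendsto (fun k => e (k + 1) i - e k i) atTop (𝓝 0) := by
  set V : ℕ → ℝ := fun k => ∑ i, v i * e k i ^ 2
  have hV : ∀ k, ∑ i, v i * (e (k + 1) i - e k i) ^ 2 = V k - V (k + 1) := fun k => (h k).sum_sq
  have hV0 : ∀ k, 0 ≤ V k := fun k =>
    Finset.sum_nonneg fun i _ => mul_nonneg (hv i).le (sq_nonneg _)
  have hanti : Antitone V := antitone_nat_of_succ_le fun k => by
    have : 0 ≤ ∑ i, v i * (e (k + 1) i - e k i) ^ 2 :=
      Finset.sum_nonneg fun i _ => mul_nonneg (hv i).le (sq_nonneg _)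
    linarith [hV k]
  have hlim := tendsto_atTop_ciInf hanti ⟨0, by rintro _ ⟨k, rfl⟩; exact hV0 k⟩
  have hdiff : Tendsto (fun k => (V k - V (k + 1)) / v i) atTop (𝓝 0) := by
    simpa using (hlim.sub (hlim.comp (tendsto_add_atTop_nat 1))).div_const (v i)
  have hsq : Tendsto (fun k => (e (k + 1) i - e k i) ^ 2) atTop (𝓝 0) := by
    refine squeeze_zero (fun k => sq_nonneg _) (fun k => ?_) hdiff
    rw [le_div_iff₀ (hv i), ← hV k, mul_comm]
    exact Finset.single_le_sum (f := fun i => v i * (e (k + 1) i - e k i) ^ 2)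
      (fun i _ => mul_nonneg (hv i).le (sq_nonneg _)) (Finset.mem_univ i)
  have := hsq.sqrt
  simp only [Real.sqrt_sq_eq_abs, Real.sqrt_zero] at this
  exact (tendsto_zero_iff_abs_tendsto_zero _).2 this

/-- A sequence whose increments tend to zero and that vanishes at bounded intervals tends to
zero. -/
theorem tendsto_zero_of_increment {f : ℕ → ℝ}
    (h : Tendsto (fun k => f (k + 1) - f k) atTop (𝓝 0)) {M : ℕ}
    (hM : ∀ k, ∃ l ≤ M, f (k + l) = 0) : Tendsto f atTop (𝓝 0) := by
  have hsum : Tendsto (fun k => ∑ l ∈ Finset.range M, |f (k + l + 1) - f (k + l)|) atTop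
      (𝓝 (∑ l ∈ Finset.range M, 0)) :=
    tendsto_finsetSum _ fun l _ =>
      ((tendsto_zero_iff_abs_tendsto_zero _).1 h).comp (tendsto_add_atTop_nat l)
  rw [Finset.sum_const_zero] at hsum
  refine squeeze_zero_norm (fun k => ?_) hsum
  obtain ⟨l, hl, hf⟩ := hM k
  have htel : ∑ m ∈ Finset.range l, (f (k + m + 1) - f (k + m)) = f (k + l) - f k := by
    simpa [add_assoc] using Finset.sum_range_sub (fun m => f (k + m)) l
  calc ‖f k‖ = |∑ m ∈ Finset.range l, (f (k + m + 1) - f (k + m))| := by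
        rw [htel, hf, zero_sub, abs_neg, Real.norm_eq_abs]
    _ ≤ ∑ m ∈ Finset.range l, |f (k + m + 1) - f (k + m)| := Finset.abs_sum_le_sum_abs _ _
    _ ≤ _ := Finset.sum_le_sum_of_subset_of_nonneg (Finset.range_subset_range.2 hl)
        fun _ _ _ => abs_nonneg _

/-- If neighbouring entries are averaged, each pair of neighbours at bounded intervals, then all
entries tend to the weighted mean. -/
theorem tendsto_of_averaging {v : Fin n → ℝ} (hv : ∀ i, 0 < v i) {e : ℕ → Fin n → ℝ}
    (h : ∀ k, IsAveraging v (e k) (e (k + 1))) {M : ℕ}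
    (hM : ∀ i j : Fin n, i.succ = j.castSucc → ∀ k, ∃ l ≤ M, e (k + l) i = e (k + l) j)
    (i : Fin n) : Tendsto (fun k => e k i) atTop (𝓝 ((∑ j, v j * e 0 j) / ∑ j, v j)) := by
  have hinc := tendsto_increment_of_averaging hv h
  have hnext : ∀ i j : Fin n, i.succ = j.castSucc →
      Tendsto (fun k => e k j - e k i) atTop (𝓝 0) := fun i j hij => by
    refine tendsto_zero_of_increment (M := M) ?_ fun k => ?_
    · have := (hinc j).sub (hinc i)
      rw [sub_zero] at this
      exact this.congr fun k => by ring
    · obtain ⟨l, hl, hle⟩ := hM i j hij k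
      exact ⟨l, hl, by rw [hle, sub_self]⟩
  have hfirst : ∀ m (hm : m < n),
      Tendsto (fun k => e k ⟨m, hm⟩ - e k ⟨0, i.pos⟩) atTop (𝓝 0) := by
    intro m
    induction m with
    | zero => simp
    | succ m ih =>
      intro hm
      have := (ih (by omega)).add (hnext ⟨m, by omega⟩ ⟨m + 1, hm⟩ (by simp))
      rw [add_zero] at this
      exact this.congr fun k => by ring
  have hall : ∀ j, Tendsto (fun k => v j * (e k j - e k i)) atTop (𝓝 0) := fun j => by
    have := ((hfirst j j.2).sub (hfirst i i.2)).const_mul (v j)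
    rw [sub_zero, mul_zero] at this
    exact this.congr fun k => by ring
  have hsum : ∀ k, ∑ j, v j * e k j = ∑ j, v j * e 0 j := fun k => by
    induction k with
    | zero => rfl
    | succ k ih => rw [(h k).sum_eq, ih]
  have hpos : 0 < ∑ j, v j := Finset.sum_pos (fun j _ => hv j) ⟨i, Finset.mem_univ i⟩
  have hlim := ((tendsto_finsetSum Finset.univ fun j _ => hall j).const_sub
    (∑ j, v j * e 0 j)).div_const (∑ j, v j)
  rw [Finset.sum_const_zero, sub_zero] at hlim
  refine hlim.congr fun k => ?_
  rw [div_eq_iff hpos.ne', ← hsum k, ← Finset.sum_sub_distrib, Finset.mul_sum]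
  exact Finset.sum_congr rfl fun j _ => by ring

/-! ### Traversing times -/

/-- What happens when robot `c` turns back from forward to backward. -/
theorem Event.eq_of_turn {c : Fin n} (h : Event R s s') (ho : s.o c = 1) (ho' : s'.o c = -1) :
    (s.y c.succ = none ∧ (s'.y c.succ).isSome = true) ∨
    (∃ j, c.succ = j.castSucc ∧ AtRight R s c ∧ AtLeft R s j ∧ s'.y = Function.update s.y c.succ
      (meetingBoundary R c j (s.y c.castSucc) (s.y c.succ) (s.y j.succ))) ∨
    ∃ j : Fin n, c.succ = Fin.last n ∧ j.castSucc = 0 ∧ AtRight R s c ∧ AtLeft R s j := by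
  have h11 : (1 : ℤˣ) ≠ -1 := by decide
  have key : ∀ i j, Function.update (Function.update s.o i (-1)) j 1 c = -1 → c = i := by
    intro i j h
    by_contra hci
    by_cases hcj : c = j
    · subst hcj; simp at h
    · rw [Function.update_of_ne hcj, Function.update_of_ne hci, ho] at h
      exact h11 h
  cases h with
  | discovery i j hij hy hai haj hoi hoj hp =>
    obtain rfl := key i j ho'
    exact Or.inl ⟨hy, by simp⟩
  | meeting i j hij hoi hoj hi hj =>
    obtain rfl := key i j ho'
    exact Or.inr (Or.inl ⟨j, hij, hi, hj, rfl⟩)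
  | meetingFixed i j hi' hj' hoi hoj hi hj =>
    obtain rfl := key i j ho'
    exact Or.inr (Or.inr ⟨j, hi', hj', hi, hj⟩)
  | _ => exact absurd (ho.symm.trans ho') h11

theorem Event.y_eq (h : Event R s s') (hs : ∀ b, (s.y b).isSome = true) :
    s'.y = s.y ∨ ∃ i j, i.succ = j.castSucc ∧ s'.y = Function.update s.y i.succ
      (meetingBoundary R i j (s.y i.castSucc) (s.y i.succ) (s.y j.succ)) := by
  cases h with
  | discovery i j hij hy | catchForward i j hij hy | catchBackward i j hij hy =>
    have := hs i.succ
    simp [hy] at this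
  | meeting i j hij hoi hoj hi hj => exact Or.inr ⟨i, j, hij, rfl⟩
  | _ => exact Or.inl rfl

theorem mul_traversingTime (s : State n) (i : Fin n) :
    R.v i * traversingTime R s i = regionLength s i - 2 * R.r i :=
  mul_div_cancel₀ _ (R.v_pos i).ne'

/-- A meeting makes the traversing times of the two robots equal and changes no others. -/
theorem traversingTime_of_meeting (hs : ∀ b, (s.y b).isSome = true) (hij : i.succ = j.castSucc)
    (hy : s'.y = Function.update s.y i.succ
      (meetingBoundary R i j (s.y i.castSucc) (s.y i.succ) (s.y j.succ))) :
    traversingTime R s' i = traversingTime R s' j ∧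
    R.v i * traversingTime R s' i + R.v j * traversingTime R s' j =
      R.v i * traversingTime R s i + R.v j * traversingTime R s j ∧
    ∀ k, k ≠ i ∧ k ≠ j → traversingTime R s' k = traversingTime R s k := by
  have hne := ne_of_succ_eq_castSucc hij
  have hji : j.succ ≠ i.succ := fun h => hne (Fin.succ_injective _ h).symm
  have hii : i.castSucc ≠ i.succ := Fin.castSucc_lt_succ.ne
  obtain ⟨b, hb⟩ := Option.isSome_iff_exists.1 (hs i.castSucc)
  obtain ⟨c, hc⟩ := Option.isSome_iff_exists.1 (hs j.succ)
  have hvi := R.v_pos i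
  have hvj := R.v_pos j
  refine ⟨?_, ?_, fun k hk => ?_⟩
  · simp only [traversingTime, regionLength, boundary, hy, ← hij, Function.update_self,
      Function.update_of_ne hji, Function.update_of_ne hii, hb, hc, meetingBoundary,
      Option.getD_some]
    field_simp
    ring
  · simp only [mul_traversingTime]
    simp only [regionLength, boundary, hy, ← hij, Function.update_self,
      Function.update_of_ne hji, Function.update_of_ne hii]
    ring
  · simp only [traversingTime, regionLength, boundary, hy]
    rw [Function.update_of_ne (fun h => hk.2 (Fin.castSucc_injective _ (h.trans hij))),
      Function.update_of_ne (fun h => hk.1 (Fin.succ_injective _ h))]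

theorem Event.isAveraging (h : Event R s s') (hs : ∀ b, (s.y b).isSome = true) :
    IsAveraging R.v (traversingTime R s) (traversingTime R s') := by
  rcases h.y_eq hs with hy | ⟨i, j, hij, hy⟩
  · left
    funext k
    simp only [traversingTime, regionLength, boundary, hy]
  · exact Or.inr ⟨i, j, ne_of_succ_eq_castSucc hij, traversingTime_of_meeting hs hij hy⟩

theorem Invariant.boundary_succ (h : Invariant R s) (i : Fin n) :
    boundary s i.succ = ∑ j ∈ Finset.Iic i, regionLength s j := by
  obtain ⟨m, hm⟩ := i
  induction m with
  | zero =>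
    have : Finset.Iic (⟨0, hm⟩ : Fin n) = {⟨0, hm⟩} := by
      ext k; simp [Fin.le_def, Fin.ext_iff]
    have h0 : (Fin.castSucc ⟨0, hm⟩ : Fin (n + 1)) = 0 := by simp
    rw [this, Finset.sum_singleton, regionLength, h0]
    simp [boundary, h.left_fixed]
  | succ m ih =>
    have : Finset.Iic (⟨m + 1, hm⟩ : Fin n) = insert ⟨m + 1, hm⟩ (Finset.Iic ⟨m, by omega⟩) := by
      ext k; simp only [Finset.mem_Iic, Finset.mem_insert, Fin.le_def, Fin.ext_iff]; omega
    rw [this, Finset.sum_insert (by simp [Fin.le_def]), ← ih (by omega), regionLength]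
    exact (sub_add_cancel _ _).symm

theorem Invariant.sum_traversingTime (h : Invariant R s) :
    ∑ i, R.v i * traversingTime R s i = R.L - 2 * ∑ i, R.r i := by
  have hsum := (Fin.sum_univ_succ (boundary s)).symm.trans (Fin.sum_univ_castSucc (boundary s))
  have h0 : boundary s 0 = 0 := by simp [boundary, h.left_fixed]
  have hl : boundary s (Fin.last n) = R.L := by simp [boundary, h.right_fixed]
  rw [h0, hl] at hsum
  simp only [mul_traversingTime, regionLength]
  rw [Finset.sum_sub_distrib, Finset.sum_sub_distrib, ← Finset.mul_sum]
  linarith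

/-! ### Runs -/

namespace Run

variable (x : Run R)

theorem exists_event_of_invariant {k : ℕ} (h : Invariant R (x.state k)) :
    ∃ τ, 0 ≤ τ ∧ x.time (k + 1) - x.time k = τ ∧ Invariant R (flow R (x.state k) τ) ∧
      Event R (flow R (x.state k) τ) (x.state (k + 1)) := by
  obtain ⟨τ, hτ⟩ : ∃ τ, x.time (k + 1) - x.time k = τ := ⟨_, rfl⟩
  have hstep := x.step k
  rw [hτ] at hstep
  generalize hs : x.state k = s at *
  generalize x.state (k + 1) = s' at *
  rcases hstep with ⟨_, _, hτ0, hfirst, hev⟩ | hnone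
  · exact ⟨τ, hτ0, hτ, h.after_flow hτ0 hfirst, hev⟩
  · obtain ⟨σ, hσ, hen⟩ := h.exists_enabled
    exact absurd hen (hnone σ hσ)

theorem invariant (hx : IsInitial R (x.state 0)) (k : ℕ) : Invariant R (x.state k) := by
  induction k with
  | zero => exact .of_initial hx
  | succ k ih =>
    obtain ⟨τ, -, -, h, hev⟩ := x.exists_event_of_invariant ih
    exact h.after_event hev

theorem exists_event (hx : IsInitial R (x.state 0)) (k : ℕ) :
    ∃ τ, 0 ≤ τ ∧ x.time (k + 1) - x.time k = τ ∧
      Event R (flow R (x.state k) τ) (x.state (k + 1)) := by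
  obtain ⟨τ, h0, hτ, -, hev⟩ := x.exists_event_of_invariant (x.invariant hx k)
  exact ⟨τ, h0, hτ, hev⟩

/-- In step `k`, robot `c` turns back from forward to backward. -/
def Turns (c : Fin n) (k : ℕ) : Prop := (x.state k).o c = 1 ∧ (x.state (k + 1)).o c = -1

/-- Every robot turns back again and again, at bounded intervals (in the number of steps). -/
theorem exists_turns (hx : IsInitial R (x.state 0)) (c : Fin n) (k : ℕ) :
    ∃ l ≤ 6 * n ^ 2 + 2 * n + 1, x.Turns c (k + l) := by
  by_contra! hno
  have hgrow : ∀ l ≤ 6 * n ^ 2 + 2 * n + 2,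
      potential c (x.state k) + l ≤ potential c (x.state (k + l)) := by
    intro l
    induction l with
    | zero => simp
    | succ l ih =>
      intro hl
      obtain ⟨τ, -, -, hev⟩ := x.exists_event hx (k + l)
      have hlt := hev.potential_lt (c := c) fun ho =>
        (Int.units_eq_one_or _).resolve_right fun ho' => hno l (by omega) ⟨ho, ho'⟩
      have hflow : potential c (flow R (x.state (k + l)) τ) = potential c (x.state (k + l)) := rfl
      have := ih (by omega)
      rw [← add_assoc]
      push_cast
      omega
  have h1 := hgrow _ le_rfl
  have h2 := (potential_bounds c (x.state k)).1
  have h3 := (potential_bounds c (x.state (k + (6 * n ^ 2 + 2 * n + 2)))).2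
  push_cast at h1
  linarith

theorem frequently_turns (hx : IsInitial R (x.state 0)) (c : Fin n) :
    ∃ᶠ k in atTop, x.Turns c k := by
  rw [frequently_atTop]
  intro k
  obtain ⟨l, -, hl⟩ := x.exists_turns hx c k
  exact ⟨k + l, by omega, hl⟩

theorem isSome_mono (hx : IsInitial R (x.state 0)) {k l : ℕ} (hkl : k ≤ l) {b : Fin (n + 1)}
    (h : ((x.state k).y b).isSome = true) : ((x.state l).y b).isSome = true := by
  induction l, hkl using Nat.le_induction with
  | base => exact h
  | succ l _ ih =>
    obtain ⟨τ, -, -, hev⟩ := x.exists_event hx l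
    exact hev.isSome_of_isSome ih

theorem eventually_known (hx : IsInitial R (x.state 0)) :
    ∀ᶠ k in atTop, ∀ b, ((x.state k).y b).isSome = true := by
  rw [eventually_all]
  intro b
  obtain ⟨k, hk⟩ : ∃ k, ((x.state k).y b).isSome = true := by
    induction b using Fin.cases with
    | zero => exact ⟨0, by simp [hx.left_fixed]⟩
    | succ i =>
      obtain ⟨k, hk⟩ := (x.frequently_turns hx i).exists
      obtain ⟨τ, -, -, hev⟩ := x.exists_event hx k
      refine ⟨k + 1, ?_⟩
      rcases hev.eq_of_turn hk.1 hk.2 with h | ⟨j, -, h, -⟩ | ⟨j, -, -, h, -⟩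
      · exact h.2
      · exact hev.isSome_of_isSome (by rw [h]; rfl)
      · exact hev.isSome_of_isSome (by rw [h]; rfl)
  exact eventually_atTop.2 ⟨k, fun l hl => x.isSome_mono hx hl hk⟩

theorem tendsto_traversingTime (hx : IsInitial R (x.state 0)) (i : Fin n) :
    Tendsto (fun k => traversingTime R (x.state k) i) atTop (𝓝 (tStar R)) := by
  obtain ⟨K, hK⟩ := eventually_atTop.1 (x.eventually_known hx)
  have hlim := tendsto_of_averaging R.v_pos (e := fun k => traversingTime R (x.state (k + K)))
    (M := 6 * n ^ 2 + 2 * n + 2) (fun k => ?_) (fun i j hij k => ?_) i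
  · simp only [(x.invariant hx _).sum_traversingTime] at hlim
    exact (tendsto_add_atTop_iff_nat K).1 hlim
  · obtain ⟨τ, -, -, hev⟩ := x.exists_event hx (k + K)
    rw [add_right_comm]
    exact hev.isAveraging (hK (k + K) (by omega))
  · obtain ⟨l, hl, hturn⟩ := x.exists_turns hx i (k + K)
    refine ⟨l + 1, by omega, ?_⟩
    obtain ⟨τ, -, -, hev⟩ := x.exists_event hx (k + K + l)
    have hknown := hK (k + K + l) (by omega)
    have hidx : k + (l + 1) + K = k + K + l + 1 := by omega
    rw [hidx]
    rcases hev.eq_of_turn hturn.1 hturn.2 with h | ⟨j', hij', -, -, hy⟩ | ⟨j', hl, -⟩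
    · have := hknown i.succ
      rw [flow_y] at h
      simp [h.1] at this
    · obtain rfl : j = j' := Fin.castSucc_injective _ (hij.symm.trans hij')
      exact (traversingTime_of_meeting hknown hij hy).1
    · exact absurd hl.symm (succ_ne_last_of_next hij)

theorem tendsto_regionLength (hx : IsInitial R (x.state 0)) (i : Fin n) :
    Tendsto (fun k => regionLength (x.state k) i) atTop (𝓝 (dStar R i)) := by
  refine (((x.tendsto_traversingTime hx i).const_mul (R.v i)).add_const (2 * R.r i)).congr
    fun k => ?_
  rw [mul_traversingTime, sub_add_cancel]

theorem tendsto_boundary (hx : IsInitial R (x.state 0)) (i : Fin n) :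
    Tendsto (fun k => boundary (x.state k) i.succ) atTop (𝓝 (yStar R i)) :=
  (tendsto_finsetSum _ fun j _ => x.tendsto_regionLength hx j).congr fun k =>
    ((x.invariant hx k).boundary_succ i).symm

theorem time_monotone (hx : IsInitial R (x.state 0)) : Monotone x.time :=
  monotone_nat_of_le_succ fun k => by
    obtain ⟨τ, h0, hτ, -⟩ := x.exists_event hx k
    linarith

theorem abs_p_sub_le (hx : IsInitial R (x.state 0)) (i : Fin n) (k : ℕ) :
    |(x.state (k + 1)).p i - (x.state k).p i| ≤ R.v i * (x.time (k + 1) - x.time k) := by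
  obtain ⟨τ, h0, hτ, hev⟩ := x.exists_event hx k
  rw [hev.p_eq, hτ]
  exact abs_flow_p_sub_le _ _ h0

/-- If the times converge, so do the positions, as the speeds are bounded. -/
theorem exists_tendsto_p (hx : IsInitial R (x.state 0)) {T : ℝ}
    (hT : Tendsto x.time atTop (𝓝 T)) (i : Fin n) :
    ∃ P, Tendsto (fun k => (x.state k).p i) atTop (𝓝 P) := by
  have hmono : Monotone fun k => (x.state k).p i + R.v i * x.time k :=
    monotone_nat_of_le_succ fun k => by
      have := (abs_le.1 (x.abs_p_sub_le hx i k)).1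
      linarith
  have hanti : Antitone fun k => (x.state k).p i - R.v i * x.time k :=
    antitone_nat_of_succ_le fun k => by
      have := (abs_le.1 (x.abs_p_sub_le hx i k)).2
      linarith
  have hle : ∀ k, x.time k ≤ T := (x.time_monotone hx).ge_of_tendsto hT
  have hbdd : BddAbove (Set.range fun k => (x.state k).p i + R.v i * x.time k) := by
    refine ⟨(x.state 0).p i - R.v i * x.time 0 + 2 * (R.v i * T), ?_⟩
    rintro _ ⟨k, rfl⟩
    have h1 := hanti (Nat.zero_le k)
    have h2 := mul_le_mul_of_nonneg_left (hle k) (R.v_pos i).le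
    simp only at h1 ⊢
    linarith
  exact ⟨_, ((tendsto_atTop_ciSup hmono hbdd).sub (hT.const_mul (R.v i))).congr fun k => by
    simp⟩

/-- If the times converged, so would the position of the first robot; but it would have to be
both at its left and at its right boundary, which are a positive traversing time apart. -/
theorem tendsto_time (hcover : 2 * ∑ i, R.r i < R.L) (hx : IsInitial R (x.state 0)) :
    Tendsto x.time atTop atTop := by
  rcases tendsto_atTop_of_monotone (x.time_monotone hx) with h | ⟨T, hT⟩
  · exact h
  exfalso
  obtain ⟨a, a', hne, -⟩ := hx.orientations
  have hn : 1 < n := by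
    have := a.2; have := a'.2; rw [Ne, Fin.ext_iff] at hne; omega
  set i : Fin n := ⟨0, by omega⟩ with hi
  -- The last robot: it turns back where it meets the first one, at the fixed boundary.
  set c : Fin n := ⟨n - 1, by omega⟩ with hc
  obtain ⟨P, hP⟩ := x.exists_tendsto_p hx hT i
  have hP' := hP.comp (tendsto_add_atTop_nat 1)
  have hP0 : P - R.r i = 0 := by
    refine tendsto_nhds_unique_of_frequently_eq (hP'.sub_const (R.r i)) tendsto_const_nhds
      ((x.frequently_turns hx c).mono fun k hk => ?_)
    obtain ⟨τ, -, -, hev⟩ := x.exists_event hx k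
    have hclast : c.succ = Fin.last n := by simp [hc, Fin.ext_iff]; omega
    have hleft := (x.invariant hx k).left_fixed
    rcases hev.eq_of_turn hk.1 hk.2 with h | ⟨j, hj, -⟩ | ⟨j, -, hj, -, h⟩
    · have := h.1
      rw [hclast, flow_y, (x.invariant hx k).right_fixed] at this
      simp at this
    · exact absurd hclast.symm (succ_ne_last_of_next hj)
    · have hji : j = i := by
        simpa [Fin.ext_iff, hi] using hj
      rw [AtLeft, hj, flow_y, hleft, Option.some.injEq, hji, ← hev.p_eq] at h
      exact h.symm
  have hP1 : P + R.r i = yStar R i := by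
    refine tendsto_nhds_unique_of_frequently_eq (hP'.add_const (R.r i)) (x.tendsto_boundary hx i)
      (((x.frequently_turns hx i).and_eventually (x.eventually_known hx)).mono
        fun k ⟨hk, hknown⟩ => ?_)
    obtain ⟨τ, -, -, hev⟩ := x.exists_event hx k
    have h : AtRight R (flow R (x.state k) τ) i := by
      rcases hev.eq_of_turn hk.1 hk.2 with h | ⟨j, -, h, -⟩ | ⟨j, -, -, h, -⟩
      · have := hknown i.succ
        rw [flow_y] at h
        simp [h.1] at this
      · exact h
      · exact h
    rw [AtRight, flow_y, ← hev.p_eq] at h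
    simp [boundary, h]
  have hIic : Finset.Iic i = {i} := by ext k; simp [hi, Fin.le_def, Fin.ext_iff]
  rw [yStar, hIic, Finset.sum_singleton, dStar] at hP1
  have ht : 0 < tStar R := div_pos (sub_pos.2 hcover)
    (Finset.sum_pos (fun j _ => R.v_pos j) ⟨i, Finset.mem_univ i⟩)
  have := mul_pos (R.v_pos i) ht
  linarith

/-- The number of the last step before time `t` tends to infinity. -/
theorem tendsto_lastStep (ht : Tendsto x.time atTop atTop) :
    Tendsto (fun t : ℝ => sSup {k : ℕ | x.time k ≤ t}) atTop atTop := by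
  refine tendsto_atTop.2 fun m => (eventually_ge_atTop (x.time m)).mono fun t hm => ?_
  refine le_csSup ?_ hm
  obtain ⟨K, hK⟩ := eventually_atTop.1 (ht.eventually_gt_atTop t)
  exact ⟨K, fun k hk => not_lt.1 fun h => (hK k h.le).not_ge hk⟩

end Run

end CycleRobots

theorem theorem1 {n : ℕ} (R : Team n) (hcover : 2 * ∑ i, R.r i < R.L)
    (x : Run R) (hx : IsInitial R (x.state 0)) :
    Filter.Tendsto x.time Filter.atTop Filter.atTop ∧
    (∀ᶠ t : ℝ in Filter.atTop, ∀ j, ((x.stateAt t).y j).isSome = true) ∧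
    ∀ i : Fin n,
      Filter.Tendsto (fun t : ℝ => traversingTime R (x.stateAt t) i) Filter.atTop
        (nhds (tStar R)) ∧
      Filter.Tendsto (fun t : ℝ => regionLength (x.stateAt t) i) Filter.atTop
        (nhds (dStar R i)) ∧
      Filter.Tendsto (fun t : ℝ => boundary (x.stateAt t) i.succ) Filter.atTop
        (nhds (yStar R i)) := by
  have ht := x.tendsto_time hcover hx
  have hlast := x.tendsto_lastStep ht
  exact ⟨ht, hlast.eventually (x.eventually_known hx), fun i =>
    ⟨(x.tendsto_traversingTime hx i).comp hlast, (x.tendsto_regionLength hx i).comp hlast,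
      (x.tendsto_boundary hx i).comp hlast⟩⟩
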